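/- Let $R$, $U_1$, $U_2$ be real random variables on a probability space, with $R>0$ almost surely, $R$ independent of $(U_1,U_2)$, and $U_1\in(0,1]$ almost surely, the distribution function of $U_1$ having upper endpoint $1$. Put $(X,Y)=(RU_1,RU_2)$. Let $F$ be the distribution function of $R$ and $\overline F=1-F$. Suppose that $F$ has infinite upper endpoint and lies in the Gumbel max-domain of attraction with positive scaling function $w$, that is, $$\lim_{x\to\infty}\frac{\overline F(x+t/w(x))}{\overline F(x)}=e^{-t}\qquad\text{for all } t\in\mathbb R .$$ Write $v(x)=x\,w(x)$. Let $a\in(0,1]$ and $U_a=\min(U_1,U_2/a)$. Suppose that $P(U_a>1-1/x)>0$ for all large $x$ and that, for all $\delta,\eta\in[0,\infty)$ and $s\in(0,\infty)$, the limit $$\xi_a(s,\delta,\eta)=\lim_{x\to\infty}\frac{P\bigl(U_1>1-(s-\delta)/x,\;U_2>a(1-(s-\eta)/x)\bigr)}{P(U_a>1-1/x)}$$ exists and is finite. Then there are $\gamma\in[0,\infty)$ and a positive measurable function $L_a$ on $(0,\infty)$, slowly varying at $0$ (that is, $\lim_{s\downarrow0}L_a(s)/L_a(ts)=1$ for all $t>0$),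 such that $$P(U_a>1-s)=s^{\gamma}L_a(s)\qquad\text{for all } s>0 .$$ Moreover, for any such $\gamma$ and $L_a$ and for all $\delta,\eta\in[0,\infty)$, $$J_{\delta,\eta}:=\int_\delta^\infty \xi_a(s,\delta,\eta)\,e^{-s}\,ds\in(0,\infty)$$ and $$P\Bigl(X>x\bigl(1+\tfrac{\delta}{v(x)}\bigr),\;Y>ax\bigl(1+\tfrac{\eta}{v(x)}\bigr)\Bigr)\sim J_{\delta,\eta}\,L_a\bigl(1/v(x)\bigr)\,v(x)^{-\gamma}\,\overline F(x)\qquad(x\to\infty),$$ where $f(x)\sim g(x)$ means $\lim_{x\to\infty}f(x)/g(x)=1$. -/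

import Mathlib

open MeasureTheory ProbabilityTheory Filter Topology

noncomputable section

/-- The upper endpoint `sup {x : F x < 1}` of a distribution function, as an extended real. -/
def upperEndpoint (F : ℝ → ℝ) : EReal :=
  sSup ((fun x : ℝ => (x : EReal)) '' {x : ℝ | F x < 1})

/-- `F ∈ GMDA(w)`: the scaling function `w` is positive and
`(1 - F (x + t / w x)) / (1 - F x) → exp (-t)` as `x → ∞`, for every real `t`. -/
def GMDA (F w : ℝ → ℝ) : Prop :=
  (∀ x : ℝ, 0 < x → 0 < w x) ∧
    ∀ t : ℝ, Tendsto (fun x : ℝ => (1 - F (x + t / w x)) / (1 - F x)) atTop (𝓝 (Real.exp (-t)))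

/-- The random variable `U_a = min (U₁, U₂ / a)`. -/
def minRatio {Ω : Type*} (U₁ U₂ : Ω → ℝ) (a : ℝ) (ω : Ω) : ℝ :=
  min (U₁ ω) (U₂ ω / a)

/-- The local condition around the point `(1, a)` with limit function `ξ`. The first clause says
that the quotients in the second one are eventually meaningful. -/
def LocalCondition {Ω : Type*} [MeasurableSpace Ω] (μ : Measure Ω) (U₁ U₂ : Ω → ℝ) (a : ℝ)
    (ξ : ℝ → ℝ → ℝ → ℝ) : Prop :=
  (∀ᶠ x : ℝ in atTop, 0 < μ.real {ω | minRatio U₁ U₂ a ω > 1 - 1 / x}) ∧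
    ∀ δ η s : ℝ, 0 ≤ δ → 0 ≤ η → 0 < s →
      Tendsto (fun x : ℝ =>
          μ.real {ω | U₁ ω > 1 - (s - δ) / x ∧ U₂ ω > a * (1 - (s - η) / x)} /
            μ.real {ω | minRatio U₁ U₂ a ω > 1 - 1 / x})
        atTop (𝓝 (ξ s δ η))

/-- A positive measurable function on `(0, ∞)` that is slowly varying at `0`. -/
def SlowlyVaryingAtZero (L : ℝ → ℝ) : Prop :=
  (∀ s : ℝ, 0 < s → 0 < L s) ∧
    Measurable (fun s : Set.Ioi (0 : ℝ) => L s) ∧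
    ∀ t : ℝ, 0 < t → Tendsto (fun s : ℝ => L s / L (t * s)) (𝓝[>] 0) (𝓝 1)

/-- `P(U_a > 1 - s) = s ^ γ * L s` for all `s > 0`, with `γ ≥ 0` and `L` slowly varying at `0`. -/
def RegularTail {Ω : Type*} [MeasurableSpace Ω] (μ : Measure Ω) (U₁ U₂ : Ω → ℝ) (a γ : ℝ)
    (L : ℝ → ℝ) : Prop :=
  0 ≤ γ ∧ SlowlyVaryingAtZero L ∧
    ∀ s : ℝ, 0 < s → μ.real {ω | minRatio U₁ U₂ a ω > 1 - s} = s ^ γ * L s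

/-- `J_{δ,η} = ∫_δ^∞ ξ(s, δ, η) exp (-s) ds`. -/
def Jint (ξ : ℝ → ℝ → ℝ → ℝ) (δ η : ℝ) : ℝ :=
  ∫ s in Set.Ioi δ, ξ s δ η * Real.exp (-s)

/-- `v(x) = x w(x)`. -/
def vfun (w : ℝ → ℝ) (x : ℝ) : ℝ := x * w x

end

/-! Write p(s) = P(U_a > 1 - s), S = 1 - F and v = v(x). For δ = η = 0 the local condition says that
p(s/x)/p(1/x) converges; the limit is monotone and multiplicative in s, hence a power s^γ
(`regular_variation_limit`), and p(s)/s^γ is slowly varying.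

For the joint tail, fix R = x + s/w(x) = x(1 + s/v). By independence the event becomes U₁ > 1 -
(s-δ)/(v+s), U₂ > a(1 - (s-η)/(v+s)), whose probability divided by p(1/v) tends to ξ(s,δ,η), while
the rescaled excess s has tail S(x + s/w(x))/S(x) → e^{-s}. So the joint tail divided by p(1/v) S(x)
should tend to J.

This is made rigorous by cutting the range of R into blocks of length h/w(x)
(`joint_tail_sandwich`). The limits of the upper and lower sums differ exactly by the factor e^{-h}
and enclose J, so h → 0 finishes (`tendsto_of_mesh_sandwich`). Limit and sum may be exchanged
because p(s/v)/p(1/v) grows at most polynomially in s, whereas S(x + s/w(x))/S(x) decays faster than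
any power, both uniformly (`exists_polynomial_growth_bound`, `exists_polynomial_decay_bound`). -/

/-! ### Regular variation at zero -/

/-- A monotone additive function on the reals is linear. -/
theorem monotone_additive_eq_mul {f : ℝ → ℝ} (hf : Monotone f) (hadd : ∀ x y, f (x + y) = f x + f y)
    (t : ℝ) : f t = t * f 1 := by
  let φ : ℝ →+ ℝ := AddMonoidHom.mk' f hadd
  have hc : Continuous φ := MeasureTheory.Measure.AddMonoidHom.continuous_of_measurable φ hf.measurable
  have h := map_real_smul φ hc t 1
  simpa [φ] using h

/-- Limits of quotients of a monotone function are powers. -/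
theorem regular_variation_limit {p g : ℝ → ℝ} (hp : Monotone p) (hpos : ∀ s, 0 < s → 0 < p s)
    (hlim : ∀ s, 0 < s → Tendsto (fun x => p (s / x) / p (1 / x)) atTop (𝓝 (g s))) :
    ∃ γ : ℝ, 0 ≤ γ ∧ ∀ s, 0 < s → g s = s ^ γ := by
  -- Insert p(t/x) between p(st/x) and p(1/x); the first quotient is the one for s, read along x/t.
  have hmul : ∀ s t, 0 < s → 0 < t → g (s * t) = g s * g t := by
    intro s t hs ht
    have h1 : Tendsto (fun x : ℝ => x / t) atTop atTop := tendsto_id.atTop_div_const ht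
    have h2 := ((hlim s hs).comp h1).mul (hlim t ht)
    refine tendsto_nhds_unique (hlim (s * t) (mul_pos hs ht)) (h2.congr' ?_)
    filter_upwards [eventually_gt_atTop 0] with x hx
    have e1 : s / (x / t) = s * t / x := by field_simp
    have e2 : 1 / (x / t) = t / x := by field_simp
    have := (hpos (t / x) (by positivity)).ne'
    simp only [Function.comp, e1, e2]
    field_simp
  have hone : g 1 = 1 := by
    refine tendsto_nhds_unique (hlim 1 one_pos) (tendsto_const_nhds.congr' ?_)
    filter_upwards [eventually_gt_atTop 0] with x hx
    exact (div_self (hpos _ (by positivity)).ne').symm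
  have hnn : ∀ s, 0 < s → 0 ≤ g s := fun s hs => ge_of_tendsto (hlim s hs) (by
    filter_upwards [eventually_gt_atTop 0] with x hx
    exact div_nonneg (hpos _ (by positivity)).le (hpos _ (by positivity)).le)
  have hgpos : ∀ s, 0 < s → 0 < g s := by
    intro s hs
    refine lt_of_le_of_ne (hnn s hs) fun h => ?_
    have := hmul s s⁻¹ hs (inv_pos.2 hs)
    rw [mul_inv_cancel₀ hs.ne', hone, ← h] at this
    simp at this
  have hmono : ∀ s t, 0 < s → s ≤ t → g s ≤ g t := fun s t hs hst =>
    le_of_tendsto_of_tendsto (hlim s hs) (hlim t (hs.trans_le hst)) (by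
      filter_upwards [eventually_gt_atTop 0] with x hx
      have := hpos (1 / x) (by positivity)
      gcongr
      exact hp (by gcongr))
  have hlin : ∀ t, Real.log (g (Real.exp t)) = t * Real.log (g (Real.exp 1)) :=
    monotone_additive_eq_mul (f := fun t => Real.log (g (Real.exp t)))
      (fun s t hst => Real.log_le_log (hgpos _ (Real.exp_pos _))
        (hmono _ _ (Real.exp_pos _) (Real.exp_le_exp.2 hst)))
      (fun s t => by
        rw [Real.exp_add, hmul _ _ (Real.exp_pos _) (Real.exp_pos _),
          Real.log_mul (hgpos _ (Real.exp_pos _)).ne' (hgpos _ (Real.exp_pos _)).ne'])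
  refine ⟨Real.log (g (Real.exp 1)), Real.log_nonneg ?_, fun s hs => ?_⟩
  · simpa only [hone] using hmono 1 (Real.exp 1) one_pos (Real.one_le_exp zero_le_one)
  · have := hlin (Real.log s)
    rw [Real.exp_log hs] at this
    rw [Real.rpow_def_of_pos hs, ← this, Real.exp_log (hgpos s hs)]

/-- A polynomial bound for the growth of a bounded monotone function of regular variation at `0`. -/
theorem exists_polynomial_growth_bound {p : ℝ → ℝ} {c : ℝ} (hp : Monotone p)
    (hpos : ∀ s, 0 < s → 0 < p s)
    (hp1 : ∀ s, p s ≤ 1) (hlim : Tendsto (fun x => p (2 / x) / p (1 / x)) atTop (𝓝 c)) :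
    ∃ (C : ℝ) (m : ℕ), 0 < C ∧
      ∀ s v, 0 ≤ s → 0 < v → p (s / v) ≤ C * (1 + s) ^ m * p (1 / v) := by
  obtain ⟨x₀, hx₀⟩ := eventually_atTop.1 ((hlim.eventually_le_const (lt_add_one c)).and
    (eventually_gt_atTop 0))
  have hx₀pos := (hx₀ x₀ le_rfl).2
  have hq := hpos (1 / x₀) (by positivity)
  -- 2^m must beat c + 1 for doubling near 0, and 1/p(1/x₀) for doubling away from 0, where p ≤ 1
  -- suffices.
  obtain ⟨m, hm⟩ := pow_unbounded_of_one_lt (max (c + 1) (1 / p (1 / x₀))) (one_lt_two (α := ℝ))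
  rw [max_lt_iff] at hm
  have hdouble : ∀ u, 0 < u → p (2 * u) ≤ 2 ^ m * p u := by
    intro u hu
    have hpu := hpos u hu
    rcases le_total x₀ (1 / u) with h | h
    · have h1 := (hx₀ (1 / u) h).1
      have e1 : 2 / (1 / u) = 2 * u := by field_simp
      have e2 : 1 / (1 / u) = u := by field_simp
      rw [e1, e2, div_le_iff₀ hpu] at h1
      exact h1.trans (by gcongr; exact hm.1.le)
    · have h2 : p (1 / x₀) ≤ p u := hp (by
        rw [div_le_iff₀ hu] at h
        rw [div_le_iff₀ hx₀pos]
        linarith)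
      have h3 := hm.2.le
      rw [div_le_iff₀ hq] at h3
      calc p (2 * u) ≤ 1 := hp1 _
        _ ≤ 2 ^ m * p (1 / x₀) := h3
        _ ≤ _ := by gcongr
  have hiter : ∀ k : ℕ, ∀ u, 0 < u → p (2 ^ k * u) ≤ (2 ^ k) ^ m * p u := by
    intro k
    induction k with
    | zero => intro u _; simp
    | succ k ih =>
      intro u hu
      calc p (2 ^ (k + 1) * u) = p (2 * (2 ^ k * u)) := by ring_nf
        _ ≤ 2 ^ m * p (2 ^ k * u) := hdouble _ (by positivity)
        _ ≤ 2 ^ m * ((2 ^ k) ^ m * p u) := by gcongr; exact ih u hu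
        _ = _ := by rw [pow_succ, mul_pow]; ring
  refine ⟨2 ^ m, m, by positivity, fun s v hs hv => ?_⟩
  obtain ⟨k, hk1, hk2⟩ := exists_nat_pow_near (x := 1 + s) (y := 2) (by linarith) one_lt_two
  have hpv := hpos (1 / v) (by positivity)
  calc p (s / v) ≤ p (2 ^ (k + 1) * (1 / v)) := hp (by
        rw [mul_one_div]; gcongr; linarith)
    _ ≤ (2 ^ (k + 1)) ^ m * p (1 / v) := hiter _ _ (by positivity)
    _ ≤ (2 * (1 + s)) ^ m * p (1 / v) := by
        gcongr; rw [pow_succ]; linarith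
    _ = _ := by rw [mul_pow]

/-- For any l < 1, 1/(v+s) ≥ l/v once v is large, so the quotient is eventually at least
p(l/v)/p(1/v) → l^γ, which is near 1 for l near 1. This replaces p(1/(v+s)) by p(1/v) in the local
condition. -/
theorem tendsto_shift_ratio {p : ℝ → ℝ} {γ : ℝ} (hp : Monotone p) (hpos : ∀ s, 0 < s → 0 < p s)
    (hlim : ∀ s, 0 < s → Tendsto (fun x => p (s / x) / p (1 / x)) atTop (𝓝 (s ^ γ)))
    {s : ℝ} (hs : 0 ≤ s) :
    Tendsto (fun v => p (1 / (v + s)) / p (1 / v)) atTop (𝓝 1) := by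
  rw [tendsto_order]
  constructor
  · intro c hc
    have hcont : Tendsto (fun l : ℝ => l ^ γ) (𝓝[<] 1) (𝓝 1) := by
      have : ContinuousAt (fun l : ℝ => l ^ γ) 1 := Real.continuousAt_rpow_const _ _ (Or.inl one_ne_zero)
      simpa [ContinuousAt] using this.tendsto.mono_left nhdsWithin_le_nhds
    obtain ⟨l, hl, hl1, hl0⟩ := ((hcont.eventually_const_lt hc).and
      ((eventually_mem_nhdsWithin).and
        (nhdsWithin_le_nhds (eventually_gt_nhds (zero_lt_one (α := ℝ)))))).exists
    have hl1 : l < 1 := hl1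
    filter_upwards [(hlim l hl0).eventually_const_lt hl, eventually_gt_atTop 0,
      eventually_ge_atTop (l * s / (1 - l))] with v h1 hv h2
    refine h1.trans_le ?_
    have := hpos (1 / v) (by positivity)
    gcongr
    apply hp
    rw [div_le_iff₀ (by linarith)] at h2
    rw [div_le_div_iff₀ hv (by linarith)]
    nlinarith
  · intro c hc
    filter_upwards [eventually_gt_atTop 0] with v hv
    refine lt_of_le_of_lt ?_ hc
    rw [div_le_one (hpos _ (by positivity))]
    exact hp (by gcongr; linarith)

/-! ### Gumbel tails -/

/-- The scaling function of a Gumbel tail: `1 / w` grows by a factor close to one at most. -/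
theorem eventually_inv_scaling_le {S w : ℝ → ℝ} (hS : Antitone S) (hpos : ∀ x, 0 < S x)
    (hw : ∀ x, 0 < x → 0 < w x)
    (hlim : ∀ t, Tendsto (fun x => S (x + t / w x) / S x) atTop (𝓝 (Real.exp (-t))))
    {e : ℝ} (he : 0 < e) :
    ∀ᶠ x in atTop, 1 / w (x + 1 / w x) ≤ (1 + e) / w x := by
  have hy : Tendsto (fun x => x + 1 / w x) atTop atTop := by
    refine tendsto_atTop_mono' _ ?_ tendsto_id
    filter_upwards [eventually_gt_atTop 0] with x hx
    have := hw x hx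
    simp only [id]
    have : 0 < 1 / w x := by positivity
    linarith
  have h1 := ((hlim 1).comp hy).mul (hlim 1)
  rw [← Real.exp_add] at h1
  have h2 := hlim (2 + e)
  -- Two successive unit steps cost a factor e^{-2}, a single step of length 2 + e costs the smaller
  -- e^{-(2+e)}; by monotonicity the two steps cannot end beyond the single one.
  have hlt : Real.exp (-(2 + e)) < Real.exp (-1 + -1) := Real.exp_lt_exp.2 (by linarith)
  obtain ⟨c, hc1, hc2⟩ := exists_between hlt
  filter_upwards [h1.eventually_const_lt hc2, h2.eventually_lt_const hc1] with x h3 h4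
  by_contra! hcon
  have h5 := h4.trans h3
  simp only [Function.comp] at h5
  rw [div_mul_div_cancel₀ (hpos _).ne', div_lt_div_iff_of_pos_right (hpos x)] at h5
  refine h5.not_ge (hS ?_)
  have : (2 + e) / w x = 1 / w x + (1 + e) / w x := by ring
  linarith

/-- Gumbel tails decay faster than any power, uniformly. -/
theorem exists_polynomial_decay_bound {S w : ℝ → ℝ} (hS : Antitone S) (hpos : ∀ x, 0 < S x)
    (hw : ∀ x, 0 < x → 0 < w x)
    (hlim : ∀ t, Tendsto (fun x => S (x + t / w x) / S x) atTop (𝓝 (Real.exp (-t)))) (m : ℕ) :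
    ∃ C : ℝ, 0 < C ∧ ∀ᶠ x in atTop, ∀ s, 0 ≤ s → S (x + s / w x) * (1 + s) ^ m ≤ C * S x := by
  set q : ℝ := Real.exp (-(1 / 2)) with hq
  have hq0 : 0 < q := Real.exp_pos _
  -- Each step multiplies S by at most q and may lengthen the next step by 1 + e; this e makes the
  -- loss outweigh the m-th power of the growth.
  obtain ⟨e, he, he1, hem⟩ : ∃ e : ℝ, 0 < e ∧ e ≤ 1 ∧ q * (1 + e) ^ m ≤ 1 := by
    refine ⟨1 / (2 * (m + 1)), by positivity, ?_, ?_⟩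
    · rw [div_le_one (by positivity)]; have : (0:ℝ) ≤ m := m.cast_nonneg; linarith
    · have h1 : (1 + 1 / (2 * ((m:ℝ) + 1))) ^ m ≤ Real.exp (1 / 2) := by
        calc (1 + 1 / (2 * ((m:ℝ) + 1))) ^ m ≤ (Real.exp (1 / (2 * ((m:ℝ) + 1)))) ^ m := by
              gcongr; linarith [Real.add_one_le_exp (1 / (2 * ((m:ℝ) + 1)))]
          _ = Real.exp (m * (1 / (2 * ((m:ℝ) + 1)))) := (Real.exp_nat_mul _ _).symm
          _ ≤ _ := by
              apply Real.exp_le_exp.2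
              rw [mul_one_div, div_le_div_iff₀ (by positivity) (by norm_num)]
              linarith
      calc q * _ ≤ q * Real.exp (1 / 2) := by gcongr
        _ = 1 := by rw [hq, ← Real.exp_add]; simp
  have hev1 : ∀ᶠ x in atTop, S (x + 1 / w x) / S x < q :=
    (hlim 1).eventually_lt_const (Real.exp_lt_exp.2 (by norm_num))
  obtain ⟨X, hX⟩ := eventually_atTop.1 ((eventually_inv_scaling_le hS hpos hw hlim he).and
    (hev1.and (eventually_gt_atTop 0)))
  -- ((1+e)^k - 1)/e is the geometric sum 1 + (1+e) + ... + (1+e)^(k-1), which bounds the length of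
  -- k steps in units of 1/w(x).
  have key : ∀ k : ℕ, ∀ x, X ≤ x → S (x + (((1 + e) ^ k - 1) / e) / w x) ≤ q ^ k * S x := by
    intro k
    induction k with
    | zero => intro x _; simp
    | succ k ih =>
      intro x hx
      obtain ⟨h1, h2, h3⟩ := hX x hx
      have hwx := hw x h3
      have hxy : x ≤ x + 1 / w x := by
        have : 0 < 1 / w x := by positivity
        linarith
      have h4 := ih _ (hx.trans hxy)
      rw [div_lt_iff₀ (hpos x)] at h2
      have hck : 0 ≤ ((1 + e) ^ k - 1) / e :=
        div_nonneg (by linarith [one_le_pow₀ (n := k) (show 1 ≤ 1 + e by linarith)]) he.le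
      calc S (x + (((1 + e) ^ (k + 1) - 1) / e) / w x)
          ≤ S (x + 1 / w x + (((1 + e) ^ k - 1) / e) / w (x + 1 / w x)) := by
            apply hS
            have := mul_le_mul_of_nonneg_left h1 hck
            have e1 : (((1 + e) ^ (k + 1) - 1) / e) / w x
                = 1 / w x + ((1 + e) ^ k - 1) / e * ((1 + e) / w x) := by
              field_simp; ring
            rw [mul_one_div] at this
            linarith
        _ ≤ q ^ k * S (x + 1 / w x) := h4
        _ ≤ q ^ k * (q * S x) := by gcongr
        _ = _ := by ring
  refine ⟨((1 + e) / e) ^ m, by positivity, ?_⟩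
  filter_upwards [eventually_ge_atTop X] with x hx s hs
  have hwx := hw x (hX x hx).2.2
  obtain ⟨k, hk1, hk2⟩ := exists_nat_pow_near (x := 1 + e * s) (y := 1 + e)
    (by nlinarith) (by linarith)
  have hs1 : 1 + s ≤ (1 + e) ^ (k + 1) / e := by
    rw [le_div_iff₀ he]; nlinarith
  have hSx := hpos x
  calc S (x + s / w x) * (1 + s) ^ m ≤ (q ^ k * S x) * ((1 + e) ^ (k + 1) / e) ^ m := by
        have h0 := (hpos (x + s / w x)).le
        gcongr
        refine le_trans (hS ?_) (key k x hx)
        gcongr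
        rw [div_le_iff₀ he]; linarith
    _ = (q * (1 + e) ^ m) ^ k * (((1 + e) / e) ^ m * S x) := by
        rw [div_pow, div_pow, mul_pow, ← pow_mul, ← pow_mul, mul_comm (k + 1) m, mul_add, pow_add]
        ring
    _ ≤ 1 * (((1 + e) / e) ^ m * S x) := by
        gcongr
        exact pow_le_one₀ (by positivity) hem
    _ = _ := one_mul _

/-- `x w(x) → ∞` for a Gumbel tail with infinite upper endpoint. -/
theorem tendsto_vfun_atTop {S w : ℝ → ℝ} (hS : Antitone S) (hpos : ∀ x, 0 < S x)
    (hS0 : Tendsto S atTop (𝓝 0)) (hw : ∀ x, 0 < x → 0 < w x)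
    (hlim : ∀ t, Tendsto (fun x => S (x + t / w x) / S x) atTop (𝓝 (Real.exp (-t)))) :
    Tendsto (vfun w) atTop atTop := by
  refine tendsto_atTop.2 fun T => ?_
  set M := Real.exp (-(-T)) + 1
  have hM : 0 < M := by positivity
  filter_upwards [(hlim (-T)).eventually_lt_const (lt_add_one _),
    hS0.eventually_lt_const (show 0 < S 0 / M from div_pos (hpos 0) hM),
    eventually_gt_atTop 0] with x h1 h2 hx
  -- If x w(x) < T, then x - T/w(x) < 0, so S there is at least S(0); but it is also at most M S(x),
  -- which is below S(0).
  by_contra! hcon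
  have hwx := hw x hx
  rw [div_lt_iff₀ (hpos x)] at h1
  rw [lt_div_iff₀ hM] at h2
  have h3 : S 0 ≤ S (x + -T / w x) := hS (by
    have : x < T / w x := by rw [lt_div_iff₀ hwx]; exact hcon
    rw [neg_div]; linarith)
  have : (M - 0) * S x = M * S x := by ring
  nlinarith

/-! ### Decomposition over blocks of R -/

theorem iUnion_Ioc_succ_eq_Ioi {r : ℕ → ℝ} (hr : Monotone r) (hr' : Tendsto r atTop atTop) :
    ⋃ i, Set.Ioc (r i) (r (i + 1)) = Set.Ioi (r 0) :=
  iUnion_Ioc_map_succ_eq_Ioi (f := r) (fun i => hr (Nat.zero_le i))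
    (not_bddAbove_of_tendsto_atTop hr')

theorem pairwise_disjoint_Ioc_succ {r : ℕ → ℝ} (hr : Monotone r) :
    Pairwise (Function.onFun Disjoint fun i => Set.Ioc (r i) (r (i + 1))) :=
  hr.pairwise_disjoint_on_Ioc_succ

theorem hasSum_measureReal_iUnion {Ω : Type*} [MeasurableSpace Ω] {μ : Measure Ω}
    [IsFiniteMeasure μ] {E : ℕ → Set Ω} (hE : ∀ i, MeasurableSet (E i))
    (hd : Pairwise (Function.onFun Disjoint E)) :
    HasSum (fun i => μ.real (E i)) (μ.real (⋃ i, E i)) := by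
  have h := measure_iUnion (μ := μ) hd hE
  have h' := ENNReal.hasSum_toReal (f := fun i => μ (E i)) (h ▸ measure_ne_top μ _)
  rw [← ENNReal.tsum_toReal_eq (fun i => measure_ne_top μ _), ← h] at h'
  exact h'

/-- Cutting the range of `R` into blocks sandwiches a joint tail probability of `(R U₁, R U₂)`. -/
theorem joint_tail_sandwich {Ω : Type*} [MeasurableSpace Ω] {μ : Measure Ω} [IsProbabilityMeasure μ]
    {R U₁ U₂ : Ω → ℝ} (hR : Measurable R) (hU₁ : Measurable U₁) (hU₂ : Measurable U₂)
    (hRpos : ∀ᵐ ω ∂μ, 0 < R ω) (hindep : IndepFun R (fun ω => (U₁ ω, U₂ ω)) μ)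
    (hU₁le : ∀ᵐ ω ∂μ, U₁ ω ≤ 1) {r : ℕ → ℝ} (hr : Monotone r) (hr' : Tendsto r atTop atTop)
    (hr0 : 0 < r 0) {c : ℝ} (hc : 0 < c) :
    μ.real {ω | R ω * U₁ ω > r 0 ∧ R ω * U₂ ω > c} ≤
      ∑' i, μ.real {ω | U₁ ω > r 0 / r (i + 1) ∧ U₂ ω > c / r (i + 1)} *
        μ.real (R ⁻¹' Set.Ioc (r i) (r (i + 1))) ∧
    ∑' i, μ.real {ω | U₁ ω > r 0 / r (i + 1) ∧ U₂ ω > c / r (i + 1)} *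
        μ.real (R ⁻¹' Set.Ioc (r (i + 1)) (r (i + 2))) ≤
      μ.real {ω | R ω * U₁ ω > r 0 ∧ R ω * U₂ ω > c} := by
  set E : Set Ω := {ω | R ω * U₁ ω > r 0 ∧ R ω * U₂ ω > c} with hE
  set B : ℕ → Set Ω := fun i => R ⁻¹' Set.Ioc (r i) (r (i + 1)) with hB
  set D : ℕ → Set Ω := fun i => {ω | U₁ ω > r 0 / r i ∧ U₂ ω > c / r i} with hD
  have hrpos : ∀ i, 0 < r i := fun i => hr0.trans_le (hr (Nat.zero_le i))
  have hEm : MeasurableSet E :=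
    (measurableSet_lt measurable_const (hR.mul hU₁)).inter
      (measurableSet_lt measurable_const (hR.mul hU₂))
  have hBm : ∀ i, MeasurableSet (B i) := fun i => hR measurableSet_Ioc
  have hBd : Pairwise (Function.onFun Disjoint B) := fun i j hij =>
    (pairwise_disjoint_Ioc_succ hr hij).preimage R
  have hBU : ⋃ i, B i = R ⁻¹' Set.Ioi (r 0) := by
    rw [← iUnion_Ioc_succ_eq_Ioi hr hr', Set.preimage_iUnion]
  have hprod : ∀ i j, μ.real (B j ∩ D i) = μ.real (D i) * μ.real (B j) := by
    intro i j
    have h := hindep.measure_inter_preimage_eq_mul (Set.Ioc (r j) (r (j + 1)))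
      (Set.Ioi (r 0 / r i) ×ˢ Set.Ioi (c / r i)) measurableSet_Ioc
      (measurableSet_Ioi.prod measurableSet_Ioi)
    rw [mul_comm]
    exact (congrArg ENNReal.toReal h).trans ENNReal.toReal_mul
  have hsum : HasSum (fun i => μ.real (B i ∩ E)) (μ.real E) := by
    have h := hasSum_measureReal_iUnion (μ := μ) (E := fun i => B i ∩ E)
      (fun i => (hBm i).inter hEm)
      (fun i j hij => (hBd hij).mono Set.inter_subset_left Set.inter_subset_left)
    rw [← Set.iUnion_inter, hBU] at h
    -- Since U₁ ≤ 1, the event forces R > r 0 almost surely, so the blocks cover it.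
    convert h using 1
    apply measureReal_congr
    filter_upwards [hRpos, hU₁le] with ω h1 h2
    apply propext
    refine ⟨fun h3 => ⟨?_, h3⟩, fun h3 => h3.2⟩
    have h4 : R ω * U₁ ω > r 0 := h3.1
    change r 0 < R ω
    nlinarith
  have hup : ∀ i, μ.real (B i ∩ E) ≤ μ.real (D (i + 1)) * μ.real (B i) := by
    intro i
    rw [← hprod]
    refine measureReal_mono ?_
    rintro ω ⟨⟨h1, h2⟩, h3, h4⟩
    have hRω : 0 < R ω := (hrpos i).trans h1
    have h5 : 0 < U₁ ω := pos_of_mul_pos_right (hr0.trans h3) hRω.le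
    have h6 : 0 < U₂ ω := pos_of_mul_pos_right (hc.trans h4) hRω.le
    refine ⟨⟨h1, h2⟩, ?_, ?_⟩ <;> rw [gt_iff_lt, div_lt_iff₀ (hrpos _), mul_comm]
    · exact h3.trans_le (mul_le_mul_of_nonneg_right h2 h5.le)
    · exact h4.trans_le (mul_le_mul_of_nonneg_right h2 h6.le)
  have hlow : ∀ i, μ.real (D i) * μ.real (B i) ≤ μ.real (B i ∩ E) := by
    intro i
    rw [← hprod]
    refine measureReal_mono ?_
    rintro ω ⟨⟨h1, h2⟩, h3, h4⟩
    have h5 : 0 < U₁ ω := lt_trans (div_pos hr0 (hrpos i)) h3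
    have h6 : 0 < U₂ ω := lt_trans (div_pos hc (hrpos i)) h4
    rw [gt_iff_lt, div_lt_iff₀ (hrpos _)] at h3 h4
    refine ⟨⟨h1, h2⟩, ?_, ?_⟩ <;> rw [gt_iff_lt]
    · linarith [mul_le_mul_of_nonneg_left h1.le h5.le]
    · linarith [mul_le_mul_of_nonneg_left h1.le h6.le]
  have hBs : Summable fun i => μ.real (B i) := (hasSum_measureReal_iUnion hBm hBd).summable
  have hS : Summable fun i => μ.real (D (i + 1)) * μ.real (B i) :=
    Summable.of_nonneg_of_le (fun i => mul_nonneg measureReal_nonneg measureReal_nonneg)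
      (fun i => mul_le_of_le_one_left measureReal_nonneg measureReal_le_one) hBs
  refine ⟨?_, ?_⟩
  · rw [← hsum.tsum_eq]
    exact hsum.summable.tsum_le_tsum hup hS
  -- The lower sum discards block 0, so that both sums carry the same factors D (i + 1).
  · have h1 : Summable fun i => μ.real (B (i + 1) ∩ E) :=
      (summable_nat_add_iff (f := fun i => μ.real (B i ∩ E)) 1).2 hsum.summable
    have h2 : ∑' i, μ.real (B (i + 1) ∩ E) ≤ μ.real E := by
      rw [← hsum.tsum_eq, hsum.summable.tsum_eq_zero_add]
      exact le_add_of_nonneg_left measureReal_nonneg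
    refine le_trans (Summable.tsum_le_tsum (fun i => hlow (i + 1)) ?_ h1) h2
    exact Summable.of_nonneg_of_le (fun i => mul_nonneg measureReal_nonneg measureReal_nonneg)
      (fun i => hlow (i + 1)) h1

/-! ### Riemann sums and the limit along fine meshes -/

theorem setIntegral_exp_neg_Ioc {a b : ℝ} (hab : a ≤ b) :
    ∫ s in Set.Ioc a b, Real.exp (-s) = Real.exp (-a) - Real.exp (-b) := by
  rw [← intervalIntegral.integral_of_le hab, intervalIntegral.integral_comp_neg (fun s => Real.exp s),
    integral_exp]

/-- Upper and lower Riemann sums for the exponential weight. -/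
theorem integral_mul_exp_neg_sandwich {g : ℝ → ℝ} {d h : ℝ} (hh : 0 < h)
    (hg : MonotoneOn g (Set.Ioi d)) (hg0 : ∀ s, d < s → 0 ≤ g s)
    (hint : IntegrableOn (fun s => g s * Real.exp (-s)) (Set.Ioi d)) {s : ℕ → ℝ}
    (hs : ∀ i : ℕ, s i = d + i * h)
    (hsum : Summable fun i => g (s (i + 1)) * (Real.exp (-s i) - Real.exp (-s (i + 1)))) :
    ∫ t in Set.Ioi d, g t * Real.exp (-t) ≤
      ∑' i, g (s (i + 1)) * (Real.exp (-s i) - Real.exp (-s (i + 1))) ∧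
    ∑' i, g (s (i + 1)) * (Real.exp (-s (i + 1)) - Real.exp (-s (i + 2))) ≤
      ∫ t in Set.Ioi d, g t * Real.exp (-t) ∧
    ∑' i, g (s (i + 1)) * (Real.exp (-s (i + 1)) - Real.exp (-s (i + 2))) =
      Real.exp (-h) * ∑' i, g (s (i + 1)) * (Real.exp (-s i) - Real.exp (-s (i + 1))) := by
  have hsucc : ∀ i, s (i + 1) = s i + h := fun i => by rw [hs, hs]; push_cast; ring
  have hmono : StrictMono s := strictMono_nat_of_lt_succ fun i => by rw [hsucc]; linarith
  have hs0 : s 0 = d := by simp [hs]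
  have htend : Tendsto s atTop atTop := by
    rw [funext hs]
    exact tendsto_atTop_add_const_left _ _ (tendsto_natCast_atTop_atTop.atTop_mul_const hh)
  have hU : ⋃ i, Set.Ioc (s i) (s (i + 1)) = Set.Ioi d := by
    rw [iUnion_Ioc_succ_eq_Ioi hmono.monotone htend, hs0]
  have hd : ∀ i, d ≤ s i := fun i => hs0 ▸ hmono.monotone (Nat.zero_le i)
  have hd' : ∀ i, d < s (i + 1) := fun i => hs0 ▸ hmono (Nat.succ_pos i)
  have hsub : ∀ i, Set.Ioc (s i) (s (i + 1)) ⊆ Set.Ioi d := fun i t ht => (hd i).trans_lt ht.1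
  have hHS : HasSum (fun i => ∫ t in Set.Ioc (s i) (s (i + 1)), g t * Real.exp (-t))
      (∫ t in Set.Ioi d, g t * Real.exp (-t)) := by
    rw [← hU] at hint ⊢
    exact hasSum_integral_iUnion (fun i => measurableSet_Ioc)
      (pairwise_disjoint_Ioc_succ hmono.monotone) hint
  have hexp : ∀ i, IntegrableOn (fun t => Real.exp (-t)) (Set.Ioc (s i) (s (i + 1))) := fun i =>
    (Continuous.integrableOn_Icc (by fun_prop)).mono_set Set.Ioc_subset_Icc_self
  have hup : ∀ i, ∫ t in Set.Ioc (s i) (s (i + 1)), g t * Real.exp (-t) ≤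
      g (s (i + 1)) * (Real.exp (-s i) - Real.exp (-s (i + 1))) := by
    intro i
    rw [← setIntegral_exp_neg_Ioc (hmono.monotone i.le_succ), ← integral_const_mul]
    refine setIntegral_mono_on (hint.mono_set (hsub i)) ((hexp i).const_mul _) measurableSet_Ioc ?_
    intro t ht
    exact mul_le_mul_of_nonneg_right (hg (hsub i ht) (hd' i) ht.2) (Real.exp_pos _).le
  have hlow : ∀ i, g (s (i + 1)) * (Real.exp (-s (i + 1)) - Real.exp (-s (i + 2))) ≤
      ∫ t in Set.Ioc (s (i + 1)) (s (i + 2)), g t * Real.exp (-t) := by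
    intro i
    rw [← setIntegral_exp_neg_Ioc (hmono.monotone (i + 1).le_succ), ← integral_const_mul]
    refine setIntegral_mono_on ((hexp (i + 1)).const_mul _) (hint.mono_set (hsub (i + 1)))
      measurableSet_Ioc ?_
    intro t ht
    exact mul_le_mul_of_nonneg_right (hg (hd' i) (hsub (i + 1) ht) ht.1.le) (Real.exp_pos _).le
  -- The mesh is uniform, so moving the exponential weight by one cell multiplies every term by
  -- e^{-h}.
  have hshift : (fun i => g (s (i + 1)) * (Real.exp (-s (i + 1)) - Real.exp (-s (i + 2)))) =
      fun i => Real.exp (-h) * (g (s (i + 1)) * (Real.exp (-s i) - Real.exp (-s (i + 1)))) := by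
    funext i
    rw [hsucc (i + 1), hsucc i]
    simp only [neg_add, Real.exp_add]
    ring
  refine ⟨?_, ?_, ?_⟩
  · rw [← hHS.tsum_eq]; exact hHS.summable.tsum_le_tsum hup hsum
  · have h1 := (summable_nat_add_iff 1).2 hHS.summable
    calc _ ≤ ∑' i, ∫ t in Set.Ioc (s (i + 1)) (s (i + 2)), g t * Real.exp (-t) :=
          Summable.tsum_le_tsum hlow (by rw [hshift]; exact hsum.mul_left _) h1
      _ ≤ _ := by
          rw [← hHS.tsum_eq, hHS.summable.tsum_eq_zero_add]
          refine le_add_of_nonneg_left (setIntegral_nonneg measurableSet_Ioc fun t ht => ?_)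
          exact mul_nonneg (hg0 t (hsub 0 ht)) (Real.exp_pos _).le
  · rw [hshift, tsum_mul_left]

/-- Comparison with inverse squares: h ≤ 1 gives 1 + d + ih ≥ h(i + 1). -/
theorem summable_inv_sq_mesh {d h : ℝ} (hd : 0 ≤ d) (hh : 0 < h) (hh1 : h ≤ 1) :
    Summable fun i : ℕ => 1 / (1 + (d + i * h)) ^ 2 := by
  have h1 : Summable fun i : ℕ => 1 / h ^ 2 * (1 / ((i + 1 : ℕ) : ℝ) ^ 2) :=
    ((summable_nat_add_iff 1).2 (Real.summable_one_div_nat_pow.2 one_lt_two)).mul_left _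
  refine Summable.of_nonneg_of_le (fun i => by positivity) (fun i => ?_) h1
  rw [one_div_mul_one_div, ← mul_pow]
  gcongr
  push_cast
  nlinarith

/-- Convergence of a ratio that is sandwiched between Riemann sums over arbitrarily fine meshes. -/
theorem tendsto_of_mesh_sandwich {H : ℝ → ℝ → ℝ} {S w p g A : ℝ → ℝ} {d C : ℝ} {m : ℕ}
    (hd : 0 ≤ d) (hS : Antitone S) (hSpos : ∀ x, 0 < S x) (hppos : ∀ s, 0 < s → 0 < p s)
    (hw : ∀ x, 0 < x → 0 < w x)
    (hSlim : ∀ t, Tendsto (fun x => S (x + t / w x) / S x) atTop (𝓝 (Real.exp (-t))))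
    (hH0 : ∀ s x, 0 ≤ H s x)
    (hHle : ∀ s v, 0 ≤ s → 0 < v → H s (v + s) ≤ C * (1 + s) ^ m * p (1 / v))
    (hHlim : ∀ s, d < s →
      Tendsto (fun x => H s (vfun w x + s) / p (1 / vfun w x)) atTop (𝓝 (g s)))
    (hg : MonotoneOn g (Set.Ioi d)) (hg0 : ∀ s, d < s → 0 ≤ g s)
    (hint : IntegrableOn (fun s => g s * Real.exp (-s)) (Set.Ioi d))
    (hA : ∀ h, 0 < h → ∀ s : ℕ → ℝ, (∀ i : ℕ, s i = d + i * h) → ∀ x, 0 < x →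
      A x ≤ ∑' i, H (s (i + 1)) (vfun w x + s (i + 1)) *
        (S (x + s i / w x) - S (x + s (i + 1) / w x)) ∧
      ∑' i, H (s (i + 1)) (vfun w x + s (i + 1)) *
        (S (x + s (i + 1) / w x) - S (x + s (i + 2) / w x)) ≤ A x) :
    Tendsto (fun x => A x / (p (1 / vfun w x) * S x)) atTop
      (𝓝 (∫ t in Set.Ioi d, g t * Real.exp (-t))) := by
  have hv : ∀ x, 0 < x → 0 < vfun w x := fun x hx => mul_pos hx (hw x hx)
  -- Of the exponent m + 2, the m absorbs the growth of H and the 2 leaves a summable bound.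
  obtain ⟨C', hC', hdecay⟩ := exists_polynomial_decay_bound hS hSpos hw hSlim (m + 2)
  have hC : 0 ≤ C := by
    have h1 := (hH0 0 (1 + 0)).trans (hHle 0 1 le_rfl one_pos)
    have h2 := hppos (1 / 1) (by norm_num)
    simp only [add_zero, one_pow, mul_one] at h1
    exact nonneg_of_mul_nonneg_left h1 h2
  set J := ∫ t in Set.Ioi d, g t * Real.exp (-t) with hJ
  have mesh : ∀ h, 0 < h → h ≤ 1 → ∃ (u l : ℝ → ℝ) (U : ℝ), Tendsto u atTop (𝓝 U) ∧
      Tendsto l atTop (𝓝 (Real.exp (-h) * U)) ∧ J ≤ U ∧ Real.exp (-h) * U ≤ J ∧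
      ∀ x, 0 < x → A x / (p (1 / vfun w x) * S x) ≤ u x ∧
        l x ≤ A x / (p (1 / vfun w x) * S x) := by
    intro h hh hh1
    obtain ⟨s, hs⟩ : ∃ s : ℕ → ℝ, ∀ i : ℕ, s i = d + i * h := ⟨_, fun i => rfl⟩
    have hsucc : ∀ i, s (i + 1) = s i + h := fun i => by rw [hs, hs]; push_cast; ring
    have hs0 : ∀ i, d ≤ s i := fun i => by
      rw [hs]; exact le_add_of_nonneg_right (by positivity)
    have hsd : ∀ i, d < s (i + 1) := fun i => by rw [hsucc]; linarith [hs0 i]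
    set bound : ℕ → ℝ := fun i => C * 2 ^ m * C' * (1 / (1 + (d + i * h)) ^ 2) with hbound
    have hbs : Summable bound := (summable_inv_sq_mesh hd hh hh1).mul_left _
    -- j = 0 gives the normalised upper sum, j = 1 the lower one.
    set f : ℕ → ℝ → ℕ → ℝ := fun j x i =>
      H (s (i + 1)) (vfun w x + s (i + 1)) / p (1 / vfun w x) *
        (S (x + s (i + j) / w x) / S x - S (x + s (i + j + 1) / w x) / S x) with hf
    set G : ℕ → ℕ → ℝ := fun j i =>
      g (s (i + 1)) * (Real.exp (-s (i + j)) - Real.exp (-s (i + j + 1))) with hG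
    have hfG : ∀ j i, Tendsto (fun x => f j x i) atTop (𝓝 (G j i)) := fun j i =>
      (hHlim _ (hsd i)).mul ((hSlim _).sub (hSlim _))
    have hfb : ∀ j, ∀ᶠ x in atTop, ∀ i, ‖f j x i‖ ≤ bound i := by
      intro j
      filter_upwards [hdecay, eventually_gt_atTop 0] with x hx hx0 i
      have hwx := hw x hx0
      have hSx := hSpos x
      have hpv := hppos (1 / vfun w x) (one_div_pos.2 (hv x hx0))
      have hsi : 0 ≤ s i := hd.trans (hs0 i)
      have h1 : 0 ≤ H (s (i + 1)) (vfun w x + s (i + 1)) / p (1 / vfun w x) :=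
        div_nonneg (hH0 _ _) hpv.le
      have h2 : H (s (i + 1)) (vfun w x + s (i + 1)) / p (1 / vfun w x) ≤
          C * (2 * (1 + s i)) ^ m := by
        rw [div_le_iff₀ hpv]
        refine (hHle _ _ (hd.trans (hsd i).le) (hv x hx0)).trans ?_
        gcongr
        · linarith [hs0 (i + 1)]
        · rw [hsucc]; linarith
      have h3 : S (x + s (i + j + 1) / w x) / S x ≤ S (x + s (i + j) / w x) / S x := by
        gcongr; apply hS; rw [hsucc]; gcongr; linarith
      have h4 : S (x + s (i + j) / w x) / S x ≤ C' / (1 + s i) ^ (m + 2) := by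
        rw [div_le_div_iff₀ hSx (by positivity)]
        refine le_trans ?_ (hx (s i) hsi)
        gcongr
        apply hS
        gcongr
        rw [hs, hs]; push_cast
        gcongr
        simp
      have h5 := div_nonneg (hSpos (x + s (i + j + 1) / w x)).le hSx.le
      rw [Real.norm_of_nonneg (mul_nonneg h1 (sub_nonneg.2 h3))]
      calc _ ≤ C * (2 * (1 + s i)) ^ m * (C' / (1 + s i) ^ (m + 2)) :=
            mul_le_mul h2 (by linarith) (sub_nonneg.2 h3) (by positivity)
        _ = bound i := by
            simp only [hbound, ← hs, mul_pow, pow_add]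
            field_simp
    have hlim : ∀ j, Tendsto (fun x => ∑' i, f j x i) atTop (𝓝 (∑' i, G j i)) := fun j =>
      tendsto_tsum_of_dominated_convergence hbs (hfG j) (hfb j)
    have hGs : Summable (G 0) := Summable.of_norm_bounded hbs fun i =>
      le_of_tendsto (hfG 0 i).norm ((hfb 0).mono fun x hx => hx i)
    obtain ⟨k1, k2, k3⟩ := integral_mul_exp_neg_sandwich hh hg hg0 hint hs hGs
    refine ⟨_, _, _, hlim 0, (show ∑' i, G 1 i = Real.exp (-h) * ∑' i, G 0 i from k3) ▸ hlim 1, k1,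
      k3 ▸ k2, fun x hx => ?_⟩
    obtain ⟨a1, a2⟩ := hA h hh s hs x hx
    have hSx := hSpos x
    have hpv := hppos (1 / vfun w x) (one_div_pos.2 (hv x hx))
    have e : ∀ j, ∑' i, f j x i = (∑' i, H (s (i + 1)) (vfun w x + s (i + 1)) *
        (S (x + s (i + j) / w x) - S (x + s (i + j + 1) / w x))) / (p (1 / vfun w x) * S x) := by
      intro j
      rw [← tsum_div_const]
      exact tsum_congr fun i => by simp only [hf]; field_simp
    rw [e 0, e 1]
    exact ⟨div_le_div_of_nonneg_right a1 (by positivity), div_le_div_of_nonneg_right a2 (by positivity)⟩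
  have hcont : Tendsto (fun h : ℝ => Real.exp (-h) * J) (𝓝[>] 0) (𝓝 J) := by
    have : Continuous fun h : ℝ => Real.exp (-h) * J := by fun_prop
    simpa using (this.tendsto 0).mono_left nhdsWithin_le_nhds
  have hcont' : Tendsto (fun h : ℝ => Real.exp h * J) (𝓝[>] 0) (𝓝 J) := by
    have : Continuous fun h : ℝ => Real.exp h * J := by fun_prop
    simpa using (this.tendsto 0).mono_left nhdsWithin_le_nhds
  have hsmall : ∀ᶠ h : ℝ in 𝓝[>] 0, 0 < h ∧ h ≤ 1 :=
    eventually_mem_nhdsWithin.and (nhdsWithin_le_nhds (eventually_le_nhds one_pos))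
  rw [tendsto_order]
  constructor
  · intro c hc
    obtain ⟨h, hch, hh, hh1⟩ := ((hcont.eventually_const_lt hc).and hsmall).exists
    obtain ⟨u, l, U, -, hl, hJU, -, hx⟩ := mesh h hh hh1
    have : c < Real.exp (-h) * U := hch.trans_le (by gcongr)
    filter_upwards [hl.eventually_const_lt this, eventually_gt_atTop 0] with x h1 h2
    exact h1.trans_le (hx x h2).2
  · intro c hc
    obtain ⟨h, hch, hh, hh1⟩ := ((hcont'.eventually_lt_const hc).and hsmall).exists
    obtain ⟨u, l, U, hu, -, -, hUJ, hx⟩ := mesh h hh hh1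
    have : U < c := by
      refine lt_of_le_of_lt ?_ hch
      calc U = Real.exp h * (Real.exp (-h) * U) := by
            rw [← mul_assoc, ← Real.exp_add]; simp
        _ ≤ _ := by gcongr
    filter_upwards [hu.eventually_lt_const this, eventually_gt_atTop 0] with x h1 h2
    exact (hx x h2).1.trans_lt h1

/-! ### Tail positivity, the slowly varying factor, the integral J -/

theorem one_sub_pos_of_upperEndpoint_eq_top {F : ℝ → ℝ} (hF : Monotone F)
    (h : upperEndpoint F = ⊤) (x : ℝ) : 0 < 1 - F x := by
  have h1 : (x : EReal) < upperEndpoint F := h ▸ EReal.coe_lt_top x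
  obtain ⟨_, ⟨y, hy, rfl⟩, hxy⟩ := lt_sSup_iff.1 h1
  have h2 : F y < 1 := hy
  linarith [hF (EReal.coe_lt_coe_iff.1 hxy).le]

theorem minRatio_gt_iff {Ω : Type*} {U₁ U₂ : Ω → ℝ} {a : ℝ} (ha : 0 < a) (c : ℝ) (ω : Ω) :
    minRatio U₁ U₂ a ω > c ↔ U₁ ω > c ∧ U₂ ω > a * c := by
  simp only [minRatio, gt_iff_lt, lt_min_iff, lt_div_iff₀ ha, mul_comm a]

/-- A positive monotone function whose quotients converge to powers is a power times a slowly
varying function. -/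
theorem slowlyVaryingAtZero_of_tendsto {p : ℝ → ℝ} {γ : ℝ} (hp : Monotone p)
    (hpos : ∀ s, 0 < s → 0 < p s)
    (hlim : ∀ s, 0 < s → Tendsto (fun x => p (s / x) / p (1 / x)) atTop (𝓝 (s ^ γ))) :
    SlowlyVaryingAtZero fun s => p s / s ^ γ := by
  refine ⟨fun s hs => div_pos (hpos s hs) (Real.rpow_pos_of_pos hs γ), ?_, fun t ht => ?_⟩
  · exact (hp.measurable.div (measurable_id.pow_const γ)).comp measurable_subtype_coe
  · have hne : t ^ γ ≠ 0 := (Real.rpow_pos_of_pos ht γ).ne'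
    have h1 := (((hlim t ht).comp tendsto_inv_nhdsGT_zero).inv₀ hne).mul_const (t ^ γ)
    rw [inv_mul_cancel₀ hne] at h1
    refine h1.congr' ?_
    filter_upwards [self_mem_nhdsWithin] with s hs
    have hs : 0 < s := hs
    have e1 := hpos s hs
    have e2 := hpos (t * s) (by positivity)
    have e3 := Real.rpow_pos_of_pos hs γ
    have e4 := Real.rpow_pos_of_pos ht γ
    simp only [Function.comp, div_inv_eq_mul, one_mul, Real.mul_rpow ht.le hs.le]
    field_simp

/-- The integrand is dominated by that of Γ(γ + 1). -/
theorem integrableOn_mul_exp_neg {g : ℝ → ℝ} {d γ : ℝ} (hd : 0 ≤ d) (hγ : 0 ≤ γ)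
    (hg : MonotoneOn g (Set.Ioi d)) (hg0 : ∀ s, d < s → 0 ≤ g s) (hle : ∀ s, d < s → g s ≤ s ^ γ) :
    IntegrableOn (fun s => g s * Real.exp (-s)) (Set.Ioi d) := by
  have h1 : IntegrableOn (fun s : ℝ => Real.exp (-s) * s ^ γ) (Set.Ioi d) := by
    have := Real.GammaIntegral_convergent (s := γ + 1) (by linarith)
    simp only [add_sub_cancel_right] at this
    exact this.mono_set (Set.Ioi_subset_Ioi hd)
  refine Integrable.mono' h1 ?_ ?_
  · exact ((aemeasurable_restrict_of_monotoneOn measurableSet_Ioi hg).mul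
      (by fun_prop)).aestronglyMeasurable
  · filter_upwards [ae_restrict_mem measurableSet_Ioi] with s hs
    have := hg0 s hs
    rw [Real.norm_of_nonneg (by positivity), mul_comm]
    gcongr
    exact hle s hs

/-- Strict positivity is asked only beyond M because ξ(s,δ,η) may vanish for s ≤ η. -/
theorem integral_mul_exp_neg_pos {g : ℝ → ℝ} {d M : ℝ} (hg0 : ∀ s, d < s → 0 ≤ g s)
    (hpos : ∀ s, M < s → d < s → 0 < g s)
    (hint : IntegrableOn (fun s => g s * Real.exp (-s)) (Set.Ioi d)) :
    0 < ∫ s in Set.Ioi d, g s * Real.exp (-s) := by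
  rw [setIntegral_pos_iff_support_of_nonneg_ae ?_ hint]
  · have hsub : Set.Ioi (max M d) ⊆
        (Function.support fun s => g s * Real.exp (-s)) ∩ Set.Ioi d := by
      intro s hs
      obtain ⟨h1, h2⟩ := max_lt_iff.1 (Set.mem_Ioi.1 hs)
      exact ⟨(mul_pos (hpos s h1 h2) (Real.exp_pos _)).ne', h2⟩
    refine lt_of_lt_of_le ?_ (measure_mono hsub)
    simp
  · filter_upwards [ae_restrict_mem measurableSet_Ioi] with s hs
    exact mul_nonneg (hg0 s hs) (Real.exp_pos _).le

/-! ### The main theorem -/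

theorem mainTheorem1 {Ω : Type*} [MeasurableSpace Ω] (μ : Measure Ω) [IsProbabilityMeasure μ]
    (R U₁ U₂ : Ω → ℝ) (hR : Measurable R) (hU₁ : Measurable U₁) (hU₂ : Measurable U₂)
    (F w : ℝ → ℝ) (hF : ∀ x : ℝ, F x = μ.real {ω | R ω ≤ x})
    (hRpos : ∀ᵐ ω ∂μ, 0 < R ω)
    (hindep : IndepFun R (fun ω => (U₁ ω, U₂ ω)) μ)
    (hFtop : upperEndpoint F = ⊤) (hGumbel : GMDA F w)
    (hU₁mem : ∀ᵐ ω ∂μ, U₁ ω ∈ Set.Ioc (0 : ℝ) 1)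
    (hU₁top : upperEndpoint (fun u => μ.real {ω | U₁ ω ≤ u}) = 1)
    (a : ℝ) (ha : a ∈ Set.Ioc (0 : ℝ) 1)
    (ξ : ℝ → ℝ → ℝ → ℝ) (hξ : LocalCondition μ U₁ U₂ a ξ) :
    (∃ (γ : ℝ) (L : ℝ → ℝ), RegularTail μ U₁ U₂ a γ L) ∧
    ∀ (γ : ℝ) (L : ℝ → ℝ), RegularTail μ U₁ U₂ a γ L →
      ∀ δ η : ℝ, 0 ≤ δ → 0 ≤ η →
        IntegrableOn (fun s => ξ s δ η * Real.exp (-s)) (Set.Ioi δ) ∧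
        0 < Jint ξ δ η ∧
        Tendsto (fun x : ℝ =>
            μ.real {ω | R ω * U₁ ω > x * (1 + δ / vfun w x) ∧
                R ω * U₂ ω > a * x * (1 + η / vfun w x)} /
              (Jint ξ δ η * L (1 / vfun w x) * (vfun w x) ^ (-γ) * (1 - F x)))
          atTop (𝓝 1) := by
  have ha0 : 0 < a := ha.1
  set p : ℝ → ℝ := fun s => μ.real {ω | minRatio U₁ U₂ a ω > 1 - s} with hp
  set H : ℝ → ℝ → ℝ → ℝ → ℝ := fun δ η s x =>
    μ.real {ω | U₁ ω > 1 - (s - δ) / x ∧ U₂ ω > a * (1 - (s - η) / x)} with hH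
  obtain ⟨hppos, hHlim⟩ : (∀ᶠ x : ℝ in atTop, 0 < p (1 / x)) ∧ ∀ δ η s : ℝ, 0 ≤ δ → 0 ≤ η → 0 < s →
      Tendsto (fun x => H δ η s x / p (1 / x)) atTop (𝓝 (ξ s δ η)) := hξ
  have hp_eq : ∀ s x, p (s / x) = H 0 0 s x := fun s x =>
    congrArg μ.real (Set.ext fun ω => by
      simpa only [sub_zero, Set.mem_ofPred_eq] using minRatio_gt_iff ha0 (1 - s / x) ω)
  have hpm : Monotone p := fun s t hst => measureReal_mono fun ω hω =>
    lt_of_le_of_lt (by linarith : 1 - t ≤ 1 - s) hω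
  have hpp : ∀ s, 0 < s → 0 < p s := by
    intro s hs
    obtain ⟨x, h1, h2, h3⟩ := (hppos.and ((eventually_ge_atTop (1 / s)).and
      (eventually_gt_atTop 0))).exists
    refine h1.trans_le (hpm ?_)
    rw [div_le_iff₀ hs] at h2
    rw [div_le_iff₀ h3]; linarith
  have hplim0 : ∀ s, 0 < s → Tendsto (fun x => p (s / x) / p (1 / x)) atTop (𝓝 (ξ s 0 0)) := by
    intro s hs
    simpa only [hp_eq s] using hHlim 0 0 s le_rfl le_rfl hs
  obtain ⟨γ₀, hγ₀, hpow⟩ := regular_variation_limit hpm hpp hplim0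
  have hplim : ∀ s, 0 < s → Tendsto (fun x => p (s / x) / p (1 / x)) atTop (𝓝 (s ^ γ₀)) :=
    fun s hs => hpow s hs ▸ hplim0 s hs
  refine ⟨⟨γ₀, fun s => p s / s ^ γ₀, hγ₀, slowlyVaryingAtZero_of_tendsto hpm hpp hplim,
    fun s hs => (mul_div_cancel₀ _ (Real.rpow_pos_of_pos hs γ₀).ne').symm⟩, ?_⟩
  -- The asymptotics are proved with p(1/v), which equals v^{-γ} L(1/v) for any admissible pair, so
  -- γ need not be identified with γ₀.
  rintro γ L ⟨-, -, hpL⟩ δ η hδ hη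
  -- monotonicity and comparison of the local probabilities
  have hH_mono : ∀ x, 0 < x → ∀ δ₁ η₁ δ₂ η₂ s t : ℝ, s - δ₁ ≤ t - δ₂ → s - η₁ ≤ t - η₂ →
      H δ₁ η₁ s x ≤ H δ₂ η₂ t x := by
    intro x hx δ₁ η₁ δ₂ η₂ s t h1 h2
    refine measureReal_mono ?_
    rintro ω ⟨h3, h4⟩
    refine ⟨lt_of_le_of_lt ?_ h3, lt_of_le_of_lt ?_ h4⟩ <;> gcongr
  have hξ_mono : ∀ δ₁ η₁ δ₂ η₂ s t : ℝ, 0 ≤ δ₁ → 0 ≤ η₁ → 0 ≤ δ₂ → 0 ≤ η₂ → 0 < s → 0 < t →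
      s - δ₁ ≤ t - δ₂ → s - η₁ ≤ t - η₂ → ξ s δ₁ η₁ ≤ ξ t δ₂ η₂ := by
    intro δ₁ η₁ δ₂ η₂ s t k1 k2 k3 k4 hs ht h1 h2
    refine le_of_tendsto_of_tendsto (hHlim _ _ _ k1 k2 hs) (hHlim _ _ _ k3 k4 ht) ?_
    filter_upwards [eventually_gt_atTop 0] with x hx
    exact div_le_div_of_nonneg_right (hH_mono x hx _ _ _ _ _ _ h1 h2) (hpp _ (by positivity)).le
  have hg : MonotoneOn (fun s => ξ s δ η) (Set.Ioi δ) := fun s hs t ht hst =>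
    hξ_mono _ _ _ _ _ _ hδ hη hδ hη (hδ.trans_lt hs) (hδ.trans_lt ht) (by linarith) (by linarith)
  have hg0 : ∀ s, δ < s → 0 ≤ ξ s δ η := fun s hs =>
    ge_of_tendsto (hHlim _ _ _ hδ hη (hδ.trans_lt hs))
      (Eventually.of_forall fun x => div_nonneg measureReal_nonneg measureReal_nonneg)
  have hgle : ∀ s, δ < s → ξ s δ η ≤ s ^ γ₀ := by
    intro s hs
    have hs0 := hδ.trans_lt hs
    rw [← hpow s hs0]
    exact hξ_mono _ _ _ _ _ _ hδ hη le_rfl le_rfl hs0 hs0 (by linarith) (by linarith)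
  -- Raising both shifts to max δ η only shrinks the event, and leaves ξ(s - max δ η, 0, 0), a
  -- positive power.
  have hgpos : ∀ s, max δ η < s → δ < s → 0 < ξ s δ η := by
    intro s hs _
    have hs0 : 0 < s - max δ η := by linarith
    refine (Real.rpow_pos_of_pos hs0 γ₀).trans_le ?_
    rw [← hpow _ hs0]
    exact hξ_mono _ _ _ _ _ _ le_rfl le_rfl hδ hη hs0 (by linarith) (by
      linarith [le_max_left δ η]) (by linarith [le_max_right δ η])
  have hint := integrableOn_mul_exp_neg hδ hγ₀ hg hg0 hgle
  have hJ : 0 < Jint ξ δ η := integral_mul_exp_neg_pos hg0 hgpos hint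
  refine ⟨hint, hJ, ?_⟩
  -- the tail of `R`
  set S : ℝ → ℝ := fun x => 1 - F x with hSdef
  have hFm : Monotone F := fun x y hxy => by
    rw [hF, hF]; exact measureReal_mono fun ω hω => le_trans hω hxy
  have hSm : Antitone S := fun x y hxy => sub_le_sub_left (hFm hxy) 1
  have hSpos : ∀ x, 0 < S x := one_sub_pos_of_upperEndpoint_eq_top hFm hFtop
  have hS0 : Tendsto S atTop (𝓝 0) := by
    have : IsProbabilityMeasure (μ.map R) := Measure.isProbabilityMeasure_map hR.aemeasurable
    have h1 := (tendsto_cdf_atTop (μ.map R)).const_sub 1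
    rw [sub_self] at h1
    refine h1.congr fun x => ?_
    rw [cdf_eq_real, map_measureReal_apply hR measurableSet_Iic]
    simp only [hSdef, hF]
    rfl
  obtain ⟨hw, hSlim⟩ := hGumbel
  have hv : Tendsto (vfun w) atTop atTop := tendsto_vfun_atTop hSm hSpos hS0 hw hSlim
  obtain ⟨C, m, -, hgrowth⟩ := exists_polynomial_growth_bound hpm hpp
    (fun s => measureReal_le_one) (hplim 2 two_pos)
  have key := tendsto_of_mesh_sandwich (H := H δ η) (S := S) (w := w) (p := p)
    (g := fun s => ξ s δ η) (d := δ) (C := C) (m := m)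
    (A := fun x => μ.real {ω | R ω * U₁ ω > x * (1 + δ / vfun w x) ∧
                R ω * U₂ ω > a * x * (1 + η / vfun w x)})
    hδ hSm hSpos hpp hw hSlim (fun s x => measureReal_nonneg) ?_ ?_ hg hg0 hint ?_
  · have h1 := key.div_const (Jint ξ δ η)
    have e : (∫ t in Set.Ioi δ, ξ t δ η * Real.exp (-t)) / Jint ξ δ η = 1 := div_self hJ.ne'
    rw [e] at h1
    refine h1.congr' ?_
    filter_upwards [hv.eventually_gt_atTop 0] with x hx
    rw [show p (1 / vfun w x) = _ from hpL (1 / vfun w x) (one_div_pos.2 hx), one_div,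
      Real.inv_rpow hx.le, ← Real.rpow_neg hx.le, div_div]
    congr 1
    ring
  · intro s v hs hv
    refine le_trans ?_ (hgrowth s v hs hv)
    calc H δ η s (v + s) ≤ H 0 0 s (v + s) :=
          hH_mono _ (by linarith) _ _ _ _ _ _ (by linarith) (by linarith)
      _ = p (s / (v + s)) := (hp_eq _ _).symm
      _ ≤ p (s / v) := hpm (by gcongr; linarith)
  · intro s hs
    have hs0 := hδ.trans_lt hs
    have h1 : Tendsto (fun v => H δ η s (v + s) / p (1 / (v + s))) atTop (𝓝 (ξ s δ η)) :=
      (hHlim δ η s hδ hη hs0).comp (tendsto_atTop_add_const_right _ s tendsto_id)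
    have h2 := h1.mul (tendsto_shift_ratio hpm hpp hplim hs0.le)
    rw [mul_one] at h2
    refine (h2.comp hv).congr' ?_
    filter_upwards [hv.eventually_gt_atTop 0] with x hx
    exact div_mul_div_cancel₀ (hpp _ (by positivity)).ne'
  · intro h hh s hs x hx
    have hwx := hw x hx
    have hvx : 0 < vfun w x := mul_pos hx hwx
    have hsm : Monotone s := fun i j hij => by
      rw [hs, hs]; gcongr
    have hs_top : Tendsto s atTop atTop := by
      rw [funext hs]
      exact tendsto_atTop_add_const_left _ _ (tendsto_natCast_atTop_atTop.atTop_mul_const hh)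
    have hs0 : s 0 = δ := by simp [hs]
    have hsnn : ∀ i, 0 ≤ s i := fun i => by rw [hs]; positivity
    have hsand := joint_tail_sandwich (r := fun i => x + s i / w x)
      (c := a * x * (1 + η / vfun w x)) hR hU₁ hU₂ hRpos hindep (hU₁mem.mono fun ω h => h.2)
      (fun i j hij => by have := hsm hij; dsimp only; gcongr)
      (tendsto_atTop_add_const_left _ _ (hs_top.atTop_div_const hwx))
      (by have := hsnn 0; positivity) (by positivity)
    have e1 : x + s 0 / w x = x * (1 + δ / vfun w x) := by
      rw [hs0, vfun]; field_simp
    -- Both sides equal (v + δ)/(v + s i); this is why H is evaluated at v + s and not at v.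
    have e2 : ∀ i, x * (1 + δ / vfun w x) / (x + s i / w x) =
        1 - (s i - δ) / (vfun w x + s i) := by
      intro i
      have := hsnn i
      rw [eq_sub_iff_add_eq, vfun]
      field_simp
      ring
    have e3 : ∀ i, a * x * (1 + η / vfun w x) / (x + s i / w x) =
        a * (1 - (s i - η) / (vfun w x + s i)) := by
      intro i
      have := hsnn i
      rw [mul_sub, eq_sub_iff_add_eq, vfun]
      field_simp
      ring
    have e4 : ∀ b c, b ≤ c → μ.real (R ⁻¹' Set.Ioc b c) = S b - S c := by
      intro b c hbc
      have : R ⁻¹' Set.Ioc b c = {ω | R ω ≤ c} \ {ω | R ω ≤ b} := by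
        ext ω; simp [and_comm]
      have hsub : {ω | R ω ≤ b} ⊆ {ω | R ω ≤ c} := fun ω hω => le_trans hω hbc
      rw [this, measureReal_sdiff hsub (measurableSet_le hR measurable_const)]
      simp only [hSdef, hF]
      ring
    have e5 : ∀ i, x + s i / w x ≤ x + s (i + 1) / w x := fun i => by
      have := hsm i.le_succ; gcongr
    simp only [e1, e2, e3, fun i => e4 _ _ (e5 i)] at hsand
    exact hsand
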